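/- Let $\mathcal{F}$ be a set system on a finite ground set $V$. The VC-dimension of $\mathcal{F}$ is the largest integer $d$ for which there is a $d$-element set $S\subseteq V$ such that every $B\subseteq S$ has the form $B=A\cap S$ with $A\in\mathcal{F}$. The dual VC-dimension of $\mathcal{F}$ is the VC-dimension of the dual system $\mathcal{F}^*=\{\{A\in\mathcal{F}: v\in A\}: v\in V\}$ on the ground set $\mathcal{F}$ (an empty set system is given VC-dimension $0$). For an $m$-coloring $\chi$ of the edges of the complete graph $K_n$ on the vertex set $V$, let $N_i(v)$ be the set of vertices joined to $v$ by an edge of color $i$; the dual VC-dimension of $\chi$ is that of the set system $\{N_i(v): 1\le i\le m,\ v\in V\}$. For integers $m\ge 1$ and $d,k_1,\dots,k_m\ge 1$, let $r_d(k_1,\dots,k_m)$ be the smallest integer $n\ge 0$ such that every $m$-coloring of the edges of $K_n$ with dual VC-dimension at most $d$ contains, for some $1\le i\le m$, a copy of $K_{k_i}$ all of whose edges have color $i$. Theorem. For all integers $d,k\ge 1$ there is a constant $c=c(d,k)$ such that for every $m\ge 1$ and all integers $k_1,\dots,k_m$ with $1\le k_i\le k$, the number $r_d(k_1,\dots,k_m)$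 exists and $$r_d(k_1,\dots,k_m)\le 2^{c(k_1+\cdots+k_m)}.$$ In particular, for fixed $d$ and $k$, $r_d(k_1,\dots,k_m)=2^{O(m)}$; that is, there is a constant $C=C(d,k)$ such that $r_d(k_1,\dots,k_m)\le 2^{Cm}$ for all such $m$ and $k_1,\dots,k_m$. -/

import Mathlib

open Finset

noncomputable section

open Classical in
/-- The dual of a set system `F` on a finite ground set `V`: its ground set is `F`, and its members
are the sets `{A ∈ F : v ∈ A}` for `v ∈ V`. -/
def dualSystem {V : Type*} [Fintype V] (F : Finset (Finset V)) : Finset (Finset (Finset V)) :=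
  univ.image fun v : V => F.filter fun A => v ∈ A

open Classical in
/-- The dual VC-dimension of a set system is the VC-dimension of its dual. -/
def dualVCDim {V : Type*} [Fintype V] (F : Finset (Finset V)) : ℕ :=
  (dualSystem F).vcDim

open Classical in
/-- The neighborhood `N_i(v)` of the vertex `v` in color `i`, for an `m`-coloring `χ` of the edges
of the complete graph on the vertex set `Fin n`. -/
def colorNbhd {n m : ℕ} (χ : SimpleGraph.TopEdgeLabeling (Fin n) (Fin m)) (i : Fin m)
    (v : Fin n) : Finset (Fin n) :=
  univ.filter fun u => (χ.labelGraph i).Adj v u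

open Classical in
/-- The set system `{N_i(v) : i ∈ [m], v ∈ V}` of all color neighborhoods. -/
def nbhdSystem {n m : ℕ} (χ : SimpleGraph.TopEdgeLabeling (Fin n) (Fin m)) :
    Finset (Finset (Fin n)) :=
  univ.image fun p : Fin m × Fin n => colorNbhd χ p.1 p.2

/-- Every `m`-coloring of the edges of `K_n` with dual VC-dimension at most `d` has, for some color
`i`, a copy of `K_{k i}` all of whose edges have color `i`. -/
def RamseyProp (d : ℕ) {m : ℕ} (k : Fin m → ℕ) (n : ℕ) : Prop :=
  ∀ χ : SimpleGraph.TopEdgeLabeling (Fin n) (Fin m), dualVCDim (nbhdSystem χ) ≤ d →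
    ∃ (i : Fin m) (s : Finset (Fin n)), (χ.labelGraph i).IsNClique (k i) s

/-- The Ramsey number `r_d(k_1, …, k_m)`: the smallest `n` with `RamseyProp d k n`. -/
def ramseyNumber (d : ℕ) {m : ℕ} (k : Fin m → ℕ) : ℕ :=
  sInf {n : ℕ | RamseyProp d k n}

end

/-! Take a counterexample `U` with `2 ^ (c * ∑ i, κ i) ≤ #U` and `∑ i, κ i` minimal. For a tuple `x`
in `U`, the vertices sharing one color pattern towards `x` that shows `t` colors make up at most a
`2 ^ (-c * t)` fraction of `U`, because each of these colors may lower its clique size by one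
(`card_pattern_class_mul_le`). So if typical vertices see many colors on `x`, the entries of a
random tuple `w` have mostly distinct patterns on `x`.

By the dual Sauer–Shelah lemma (`card_color_patterns_le`) the number of patterns is polynomial in
the number of colors that the entries of `x` see on `w`. Hence many colors on short tuples force
many more on longer ones (`avgColors_growth`). Iterating this exceeds the finite number of colors
(`false_of_small_fibers`). -/

/-! ### Collisions and averages over random tuples -/

/-- The number of distinct values of a map is at least the number of points minus the number of
collisions. -/
lemma card_le_card_image_add_collisions {ι β : Type*} [DecidableEq ι] [DecidableEq β]
    (s : Finset ι) (g : ι → β) :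
    #s ≤ #(s.image g) + #(s.offDiag.filter fun e => g e.1 = g e.2) := by
  induction s using Finset.induction_on with
  | empty => exact Nat.zero_le _
  | insert a s ha ih =>
    rw [card_insert_of_notMem ha, image_insert]
    have hmono : s.offDiag.filter (fun e => g e.1 = g e.2) ⊆
        (insert a s).offDiag.filter (fun e => g e.1 = g e.2) :=
      filter_subset_filter _ (offDiag_mono (subset_insert a s))
    by_cases h : g a ∈ s.image g
    · rw [insert_eq_of_mem h]
      obtain ⟨b, hb, hab⟩ := mem_image.1 h
      have : #(s.offDiag.filter fun e => g e.1 = g e.2) <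
          #((insert a s).offDiag.filter fun e => g e.1 = g e.2) := by
        refine card_lt_card (hmono.ssubset_of_mem_notMem (a := (a, b)) ?_ ?_)
        · exact mem_filter.2 ⟨mem_offDiag.2 ⟨mem_insert_self a s, mem_insert_of_mem hb,
            fun h => ha ((show a = b from h) ▸ hb)⟩, hab.symm⟩
        · exact fun h => ha (mem_offDiag.1 (mem_filter.1 h).1).1
      omega
    · rw [card_insert_of_notMem h]
      have := card_le_card hmono
      omega

lemma sum_fun_apply {ι U : Type*} [Fintype ι] [DecidableEq ι] [Fintype U]
    (F : U → ℝ) (a : ι) :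
    ∑ w : ι → U, F (w a) =
      (Fintype.card U : ℝ) ^ (Fintype.card ι - 1) * ∑ u, F u := by
  classical
  have := Fintype.sum_piFinset_apply F (univ : Finset U) a
  rw [Fintype.piFinset_univ] at this
  simpa using this

/-- Once all coordinates except `b` are fixed, at most `K` values remain for `w b`. This bounds the
expected number of collisions in a random tuple. -/
lemma card_fun_rel_le {ι U : Type*} [Fintype ι] [DecidableEq ι] [Fintype U]
    (R : U → U → Prop) [DecidableRel R] (K : ℝ)
    (hR : ∀ u, (#{v | R u v} : ℝ) ≤ K) {a b : ι} (hab : a ≠ b) :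
    (#{w : ι → U | R (w a) (w b)} : ℝ) ≤
      (Fintype.card U : ℝ) ^ (Fintype.card ι - 1) * K := by
  have h1 : (#{w : ι → U | R (w a) (w b)} : ℝ) =
      ∑ r : {j // j ≠ b} → U, (#{v | R (r ⟨a, hab⟩) v} : ℝ) := by
    rw [card_filter, ← (Equiv.funSplitAt b U).symm.sum_comp, Fintype.sum_prod_type_right]
    push_cast
    refine sum_congr rfl fun r _ => ?_
    rw [card_filter]
    push_cast
    refine sum_congr rfl fun v _ => ?_
    simp [Equiv.funSplitAt, Equiv.piSplitAt, hab]
  rw [h1]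
  refine (sum_le_sum fun r _ => hR _).trans ?_
  simp [Fintype.card_subtype_compl]

/-! ### Growth of the average number of colors -/

/-- The number of distinct values of `f w` on the tuple `x`. -/
def numColors {ι U C : Type*} [Fintype ι] [DecidableEq C] (f : U → U → C) (x : ι → U) (w : U) : ℕ :=
  #(univ.image fun j => f w (x j))

/-- The average number of distinct values of `f w` on a random `q`-tuple, for a random `w`. -/
noncomputable def avgColors {U C : Type*} [Fintype U] [DecidableEq C] (f : U → U → C) (q : ℕ) : ℝ :=
  (∑ x : Fin q → U, ∑ w, (numColors f x w : ℝ)) / (Fintype.card U : ℝ) ^ (q + 1)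

section
variable {U C : Type*} [DecidableEq C] {f : U → U → C}

lemma numColors_le {ι : Type*} [Fintype ι] (x : ι → U) (w : U) :
    numColors f x w ≤ Fintype.card ι := card_image_le

variable [Fintype U]

lemma sum_numColors [Nonempty U] (q : ℕ) :
    ∑ x : Fin q → U, ∑ w, (numColors f x w : ℝ) =
      avgColors f q * (Fintype.card U : ℝ) ^ (q + 1) := by
  rw [avgColors, div_mul_cancel₀]
  positivity

lemma avgColors_le_card [Nonempty U] [Fintype C] (q : ℕ) :
    avgColors f q ≤ Fintype.card C := by
  rw [avgColors, div_le_iff₀ (by positivity)]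
  calc _ ≤ ∑ x : Fin q → U, ∑ w : U, (Fintype.card C : ℝ) :=
        sum_le_sum fun x _ => sum_le_sum fun w _ => by
          exact_mod_cast card_le_univ _
    _ = _ := by simp [pow_succ]; ring

/-- If the fibres of each `f u` are small, a random tuple sees mostly distinct values. -/
lemma le_avgColors [DecidableEq U] [Nonempty U] (q : ℕ) (ε : ℝ)
    (hf : ∀ w u, (#{v | f w u = f w v} : ℝ) ≤ ε * Fintype.card U) :
    q - q ^ 2 * ε ≤ avgColors f q := by
  set N : ℝ := (Fintype.card U : ℝ) with hN
  have hNpos : 0 < N := by positivity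
  have hε : 0 ≤ ε := by
    obtain ⟨u⟩ := ‹Nonempty U›
    have := (Nat.cast_nonneg _).trans (hf u u)
    exact nonneg_of_mul_nonneg_left this hNpos
  have key : ∀ w : U, (q - q ^ 2 * ε) * N ^ q ≤ ∑ x : Fin q → U, (numColors f x w : ℝ) := by
    intro w
    have h1 : ∀ x : Fin q → U, (q : ℝ) ≤ numColors f x w +
        ∑ e ∈ (univ : Finset (Fin q)).offDiag, if f w (x e.1) = f w (x e.2) then (1 : ℝ) else 0 := by
      intro x
      have := card_le_card_image_add_collisions (univ : Finset (Fin q)) (fun j => f w (x j))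
      rw [card_filter, card_univ, Fintype.card_fin] at this
      exact_mod_cast this
    have h2 := sum_le_sum fun x (_ : x ∈ (univ : Finset (Fin q → U))) => h1 x
    rw [sum_add_distrib, sum_comm (t := (univ : Finset (Fin q)).offDiag)] at h2
    have h3 : ∑ e ∈ (univ : Finset (Fin q)).offDiag, ∑ x : Fin q → U,
        (if f w (x e.1) = f w (x e.2) then (1 : ℝ) else 0) ≤ q ^ 2 * (ε * N ^ q) := by
      have : ∀ e ∈ (univ : Finset (Fin q)).offDiag, ∑ x : Fin q → U,
        (if f w (x e.1) = f w (x e.2) then (1 : ℝ) else 0) ≤ ε * N ^ q := by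
        intro e he
        have := card_fun_rel_le (fun u v => f w u = f w v) _ (hf w) (mem_offDiag.1 he).2.2
        rw [card_filter] at this
        push_cast at this
        refine this.trans (le_of_eq ?_)
        have hq : 0 < q := e.1.pos
        rw [Fintype.card_fin, ← hN]
        obtain ⟨r, rfl⟩ : ∃ r, q = r + 1 := ⟨q - 1, by omega⟩
        simp [pow_succ]; ring
      refine (sum_le_card_nsmul _ _ _ this).trans ?_
      rw [nsmul_eq_mul]
      gcongr
      rw [offDiag_card]
      simp only [card_univ, Fintype.card_fin]
      have : q * q - q ≤ q ^ 2 := by rw [sq]; exact Nat.sub_le _ _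
      exact_mod_cast this
    simp only [sum_const, card_univ, Fintype.card_fun, Fintype.card_fin, nsmul_eq_mul] at h2
    push_cast at h2
    rw [← hN] at h2
    nlinarith
  rw [avgColors, le_div_iff₀ (by positivity), sum_comm]
  calc (q - q ^ 2 * ε) * N ^ (q + 1) = ∑ _w : U, (q - q ^ 2 * ε) * N ^ q := by
        simp [pow_succ, hN]; ring
    _ ≤ _ := sum_le_sum fun w _ => key w

/-- The upper bound on the number of patterns, summed over all pairs of tuples. -/
lemma sum_card_patterns_le [Nonempty U] {d : ℕ} (hd : 0 < d)
    (hvc : ∀ (q p : ℕ) (x : Fin q → U) (w : Fin p → U),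
      #(univ.image fun a j => f (w a) (x j)) ≤ (∑ j, numColors f w (x j) + 1) ^ d)
    (q P : ℕ) (hq : 0 < q) :
    ∑ x : Fin q → U, ∑ w : Fin (P ^ d) → U, (#(univ.image fun a j => f (w a) (x j)) : ℝ) ≤
      (P : ℝ) ^ (d - 1) * (q * avgColors f (P ^ d) + 1) *
        (Fintype.card U : ℝ) ^ (q + P ^ d) := by
  set N : ℝ := (Fintype.card U : ℝ) with hN
  have hpt : ∀ (x : Fin q → U) (w : Fin (P ^ d) → U),
      (#(univ.image fun a j => f (w a) (x j)) : ℝ) ≤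
        (P : ℝ) ^ (d - 1) * (∑ j, (numColors f w (x j) : ℝ) + 1) := by
    intro x w
    have h1 := hvc q (P ^ d) x w
    have h2 : #(univ.image fun a j => f (w a) (x j)) ≤ P ^ d := by
      simpa using card_image_le (s := (univ : Finset (Fin (P ^ d))))
        (f := fun a j => f (w a) (x j))
    set M := ∑ j, numColors f w (x j) with hM
    -- The minimum of `(M + 1) ^ d` and `P ^ d` is at most `P ^ (d - 1) * (M + 1)`. This bound is
    -- linear in `M`, so it can be averaged.
    have h3 : #(univ.image fun a j => f (w a) (x j)) ≤ P ^ (d - 1) * (M + 1) := by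
      obtain ⟨e, rfl⟩ : ∃ e, d = e + 1 := ⟨d - 1, by omega⟩
      rw [Nat.add_sub_cancel]
      rcases le_total (M + 1) P with h | h
      · refine h1.trans ?_
        rw [pow_succ]
        gcongr
      · refine h2.trans ?_
        rw [pow_succ]
        gcongr
    calc (#(univ.image fun a j => f (w a) (x j)) : ℝ) ≤ ((P ^ (d - 1) * (M + 1) : ℕ) : ℝ) := by
          exact_mod_cast h3
      _ = _ := by rw [hM]; push_cast; rfl
  refine (sum_le_sum fun x _ => sum_le_sum fun w _ => hpt x w).trans (le_of_eq ?_)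
  simp_rw [← mul_sum, sum_add_distrib]
  rw [sum_comm]
  have h4 : ∀ w : Fin (P ^ d) → U, ∑ x : Fin q → U, ∑ j, (numColors f w (x j) : ℝ) =
      q * N ^ (q - 1) * ∑ u, (numColors f w u : ℝ) := by
    intro w
    rw [sum_comm]
    simp_rw [sum_fun_apply (fun u => (numColors f w u : ℝ))]
    simp [hN, mul_assoc]
  simp_rw [h4, ← mul_sum, sum_numColors]
  obtain ⟨r, rfl⟩ : ∃ r, q = r + 1 := ⟨q - 1, by omega⟩
  simp only [sum_const, card_univ, Fintype.card_fun, Fintype.card_fin, nsmul_eq_mul]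
  push_cast
  rw [← hN]
  ring

/-- The lower bound on the number of patterns, summed over all pairs of tuples. -/
lemma le_sum_card_patterns [DecidableEq U] [Nonempty U] {q p Q : ℕ} (hq : 0 < q) (hp : 0 < p)
    (ε : ℝ) (hε : 0 ≤ ε)
    (hfib : ∀ (x : Fin q → U) (w : U), Q ≤ 2 * numColors f x w →
      (#{w' | ∀ j, f w (x j) = f w' (x j)} : ℝ) ≤ ε * Fintype.card U)
    (hQ : (Q : ℝ) ≤ avgColors f q) :
    (p * Q / (2 * q) - p ^ 2 * ε) * (Fintype.card U : ℝ) ^ (q + p) ≤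
    ∑ x : Fin q → U, ∑ w : Fin p → U, (#(univ.image fun a j => f (w a) (x j)) : ℝ) := by
  set N : ℝ := (Fintype.card U : ℝ) with hN
  have hNpos : 0 < N := by positivity
  let good : (Fin q → U) → U → Prop := fun x w => Q ≤ 2 * numColors f x w
  let G : (Fin q → U) → U → ℝ := fun x w => if good x w then 1 else 0
  -- Reverse Markov: the count never exceeds `q` and averages at least `Q`, so it reaches `Q / 2`
  -- with probability at least `Q / (2 * q)`.
  have hgood : Q / (2 * q) * N ^ (q + 1) ≤ ∑ x : Fin q → U, ∑ w, G x w := by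
    have h1 : ∀ (x : Fin q → U) w, 2 * (numColors f x w : ℝ) ≤ 2 * q * G x w + Q := by
      intro x w
      have h2 : numColors f x w ≤ q := by simpa using numColors_le (f := f) x w
      have h2' : (numColors f x w : ℝ) ≤ q := by exact_mod_cast h2
      by_cases h : good x w
      · have : G x w = 1 := if_pos h
        have hQ0 : (0 : ℝ) ≤ Q := by positivity
        rw [this]; linarith
      · have : G x w = 0 := if_neg h
        have h3 : 2 * (numColors f x w : ℝ) ≤ Q := by exact_mod_cast (not_le.1 h).le
        rw [this]; linarith
    have h2 := sum_le_sum fun x (_ : x ∈ (univ : Finset (Fin q → U))) =>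
      sum_le_sum fun w (_ : w ∈ (univ : Finset U)) => h1 x w
    simp_rw [sum_add_distrib, ← mul_sum, sum_numColors] at h2
    simp only [sum_const, card_univ, Fintype.card_fun, Fintype.card_fin, nsmul_eq_mul] at h2
    push_cast at h2
    rw [← hN] at h2
    have h3 : (Q : ℝ) * N ^ (q + 1) ≤ avgColors f q * N ^ (q + 1) := by gcongr
    have h4 : N ^ q * (N * Q) = Q * N ^ (q + 1) := by ring
    rw [h4] at h2
    have hq' : (0 : ℝ) < 2 * q := by positivity
    rw [div_mul_eq_mul_div, div_le_iff₀ hq']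
    linarith
  have hpt : ∀ (x : Fin q → U) (w : Fin p → U), ∑ a, G x (w a) ≤
      (#(univ.image fun a j => f (w a) (x j)) : ℝ) +
      ∑ e ∈ (univ : Finset (Fin p)).offDiag,
        if good x (w e.1) ∧ ∀ j, f (w e.1) (x j) = f (w e.2) (x j) then (1 : ℝ) else 0 := by
    intro x w
    have h1 := card_le_card_image_add_collisions (univ.filter fun a => good x (w a))
      (fun a j => f (w a) (x j))
    have h2 : #((univ.filter fun a => good x (w a)).image fun a j => f (w a) (x j)) ≤
        #(univ.image fun a j => f (w a) (x j)) :=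
      card_le_card (image_subset_image (filter_subset _ _))
    have h3 : #((univ.filter fun a => good x (w a)).offDiag.filter
        fun e => (fun j => f (w e.1) (x j)) = fun j => f (w e.2) (x j)) ≤
        #((univ : Finset (Fin p)).offDiag.filter fun e =>
          good x (w e.1) ∧ ∀ j, f (w e.1) (x j) = f (w e.2) (x j)) := by
      refine card_le_card fun e he => ?_
      simp only [mem_filter, mem_offDiag, mem_univ, true_and] at he ⊢
      exact ⟨he.1.2.2, he.1.1, fun j => congrFun he.2 j⟩
    have h4 := h1.trans (Nat.add_le_add h2 h3)
    rw [card_filter, card_filter] at h4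
    simp only [G]
    exact_mod_cast h4
  have hcoll : ∀ x : Fin q → U, ∑ w : Fin p → U, ∑ e ∈ (univ : Finset (Fin p)).offDiag,
      (if good x (w e.1) ∧ ∀ j, f (w e.1) (x j) = f (w e.2) (x j) then (1 : ℝ) else 0) ≤
      p ^ 2 * (ε * N ^ p) := by
    intro x
    rw [sum_comm]
    have h1 : ∀ e ∈ (univ : Finset (Fin p)).offDiag, ∑ w : Fin p → U,
        (if good x (w e.1) ∧ ∀ j, f (w e.1) (x j) = f (w e.2) (x j) then (1 : ℝ) else 0) ≤
        ε * N ^ p := by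
      intro e he
      have h2 := card_fun_rel_le (fun u v => good x u ∧ ∀ j, f u (x j) = f v (x j)) (ε * N)
        (fun u => by
          by_cases hu : good x u
          · simpa [hu] using hfib x u hu
          · simpa [hu] using by positivity) (mem_offDiag.1 he).2.2
      rw [card_filter] at h2
      push_cast at h2
      refine h2.trans (le_of_eq ?_)
      rw [Fintype.card_fin, ← hN]
      obtain ⟨r, rfl⟩ : ∃ r, p = r + 1 := ⟨p - 1, by omega⟩
      simp [pow_succ]; ring
    refine (sum_le_card_nsmul _ _ _ h1).trans ?_
    rw [nsmul_eq_mul]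
    gcongr
    rw [offDiag_card]
    simp only [card_univ, Fintype.card_fin]
    have : p * p - p ≤ p ^ 2 := by rw [sq]; exact Nat.sub_le _ _
    exact_mod_cast this
  have hsum := sum_le_sum fun x (_ : x ∈ (univ : Finset (Fin q → U))) =>
      sum_le_sum fun w (_ : w ∈ (univ : Finset (Fin p → U))) => hpt x w
  simp_rw [sum_add_distrib] at hsum
  have hfirst : ∀ x : Fin q → U, ∑ w : Fin p → U, ∑ a, G x (w a) =
      p * N ^ (p - 1) * ∑ u, G x u := by
    intro x
    rw [sum_comm]
    simp_rw [sum_fun_apply (G x)]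
    simp [hN, mul_assoc]
  simp_rw [hfirst, ← mul_sum] at hsum
  have hcoll' := sum_le_sum fun x (_ : x ∈ (univ : Finset (Fin q → U))) => hcoll x
  simp only [sum_const, card_univ, Fintype.card_fun, Fintype.card_fin, nsmul_eq_mul] at hcoll'
  push_cast at hcoll'
  rw [← hN] at hcoll'
  have hmul : p * N ^ (p - 1) * (Q / (2 * q) * N ^ (q + 1)) ≤
      p * N ^ (p - 1) * ∑ x : Fin q → U, ∑ w, G x w := by gcongr
  have e1 : p * N ^ (p - 1) * (Q / (2 * q) * N ^ (q + 1)) = p * Q / (2 * q) * N ^ (q + p) := by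
    obtain ⟨r, rfl⟩ : ∃ r, p = r + 1 := ⟨p - 1, by omega⟩
    simp only [Nat.add_sub_cancel]
    ring
  have e2 : N ^ q * (p ^ 2 * (ε * N ^ p)) = p ^ 2 * ε * N ^ (q + p) := by ring
  rw [e1] at hmul
  rw [e2] at hcoll'
  rw [sub_mul]
  linarith

/-- One step of the growth of the average number of colors. -/
lemma avgColors_growth [DecidableEq U] [Nonempty U]
    {d Q : ℕ} (hd : 0 < d)
    (hvc : ∀ (q p : ℕ) (x : Fin q → U) (w : Fin p → U),
      #(univ.image fun a j => f (w a) (x j)) ≤ (∑ j, numColors f w (x j) + 1) ^ d)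
    (hfib : ∀ (q : ℕ) (x : Fin q → U) (w : U),
      (#{w' | ∀ j, f w (x j) = f w' (x j)} : ℝ) ≤
        (1 / 2) ^ (72 * d ^ 2 * numColors f x w) * Fintype.card U)
    (hQ2 : 2 ≤ Q) (hQ : (Q : ℝ) ≤ avgColors f (Q ^ (2 * d))) :
    ((Q ^ (6 * d) : ℕ) : ℝ) ≤ avgColors f ((Q ^ (6 * d)) ^ (2 * d)) := by
  obtain ⟨q, hqdef⟩ : ∃ q, q = Q ^ (2 * d) := ⟨_, rfl⟩
  have hq2 : 2 ≤ q := hqdef ▸ hQ2.trans (Nat.le_self_pow (by omega) Q)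
  obtain ⟨p, hpdef⟩ : ∃ p, p = (q ^ 6) ^ d := ⟨_, rfl⟩
  have hp1 : 1 ≤ p := hpdef ▸ Nat.one_le_pow _ _ (by positivity)
  have e1 : (Q ^ (6 * d)) ^ (2 * d) = p := by
    rw [hpdef, hqdef]; simp only [← pow_mul]; congr 1; ring
  have e2 : Q ^ (6 * d) = q ^ 3 := by
    rw [hqdef]; simp only [← pow_mul]; congr 1; ring
  have e3 : p ^ 3 = Q ^ (36 * d ^ 2) := by
    rw [hpdef, hqdef]; simp only [← pow_mul]; congr 1; ring
  rw [e1, e2]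
  rw [← hqdef] at hQ
  have hupper := sum_card_patterns_le hd hvc q (q ^ 6) (by omega)
  have hlower := le_sum_card_patterns (f := f) (q := q) (p := p) (Q := Q) (by omega) hp1
    (1 / (p : ℝ) ^ 3) (by positivity) (fun x w hw => by
      refine (hfib q x w).trans ?_
      gcongr
      rw [one_div, inv_pow, ← one_div]
      gcongr
      -- The source of 72: `p ^ 3 = Q ^ (36 * d ^ 2)`, `Q ≤ 2 ^ Q`, and a good vertex sees at least
      -- `Q / 2` colors.
      have : p ^ 3 ≤ 2 ^ (72 * d ^ 2 * numColors f x w) := by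
        rw [e3]
        calc Q ^ (36 * d ^ 2) ≤ (2 ^ Q) ^ (36 * d ^ 2) := by gcongr; exact Nat.lt_two_pow_self.le
          _ = 2 ^ (36 * d ^ 2 * Q) := by rw [← pow_mul]; congr 1; ring
          _ ≤ 2 ^ (36 * d ^ 2 * (2 * numColors f x w)) := by gcongr; norm_num
          _ = _ := by congr 1; ring
      exact_mod_cast this) hQ
  rw [← hpdef] at hupper
  have h := le_of_mul_le_mul_right (hlower.trans hupper) (by positivity)
  set A := avgColors f p
  have hp : (p : ℝ) = (q : ℝ) ^ 6 * ((q ^ 6 : ℕ) : ℝ) ^ (d - 1) := by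
    obtain ⟨e, rfl⟩ : ∃ e, d = e + 1 := ⟨d - 1, by omega⟩
    rw [hpdef]; push_cast; ring
  set B : ℝ := ((q ^ 6 : ℕ) : ℝ) ^ (d - 1) with hB
  have hB1 : 1 ≤ B := one_le_pow₀ (by exact_mod_cast Nat.one_le_pow _ _ (by omega))
  have hqR : (2 : ℝ) ≤ q := by exact_mod_cast hq2
  have hQR : (2 : ℝ) ≤ Q := by exact_mod_cast hQ2
  have hpR : (1 : ℝ) ≤ p := by exact_mod_cast hp1
  have h5 : (p : ℝ) * Q / (2 * q) ≥ B * q ^ 5 := by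
    rw [hp, ge_iff_le, le_div_iff₀ (by positivity)]
    have : B * (q : ℝ) ^ 6 * 2 ≤ B * (q : ℝ) ^ 6 * Q := by gcongr
    nlinarith
  have h6 : (p : ℝ) ^ 2 * (1 / (p : ℝ) ^ 3) ≤ 1 := by
    rw [mul_one_div, div_le_one (by positivity)]
    exact pow_le_pow_right₀ hpR (by norm_num)
  have h7 : B * (q : ℝ) ^ 5 ≤ B * (q * A + 2) := by nlinarith
  have h8 := le_of_mul_le_mul_left h7 (by positivity)
  push_cast
  have h9 : (q : ℝ) ^ 4 + 2 ≤ q ^ 5 := by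
    have : (2 : ℝ) ≤ q ^ 4 := by
      calc (2 : ℝ) ≤ q := hqR
        _ ≤ q ^ 4 := le_self_pow₀ (by linarith) (by norm_num)
    nlinarith
  have h10 : (q : ℝ) * q ^ 3 ≤ q * A := by nlinarith
  exact le_of_mul_le_mul_left h10 (by positivity)

/-- A symmetric edge labelling by finitely many colors cannot have both polynomially many patterns
and exponentially small pattern classes. -/
lemma false_of_small_fibers [DecidableEq U] [Nonempty U] [Fintype C]
    (hsymm : ∀ u v, f u v = f v u) {d : ℕ} (hd : 0 < d)
    (hvc : ∀ (q p : ℕ) (x : Fin q → U) (w : Fin p → U),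
      #(univ.image fun a j => f (w a) (x j)) ≤ (∑ j, numColors f w (x j) + 1) ^ d)
    (hfib : ∀ (q : ℕ) (x : Fin q → U) (w : U),
      (#{w' | ∀ j, f w (x j) = f w' (x j)} : ℝ) ≤
        (1 / 2) ^ (72 * d ^ 2 * numColors f x w) * Fintype.card U) : False := by
  -- Patterns on one vertex `w` are, by symmetry, the fibres of `f w`; they are so small that a
  -- random tuple loses at most one value on average.
  have hbase : ((2 : ℕ) : ℝ) ≤ avgColors f (2 ^ (2 * d)) := by
    refine le_trans ?_ (le_avgColors (f := f) _ ((1 / 2) ^ (72 * d ^ 2)) fun w u => ?_)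
    · have h1 : ((1 : ℝ) / 2) ^ (72 * d ^ 2) ≤ (1 / 2) ^ (4 * d) :=
        pow_le_pow_of_le_one (by norm_num) (by norm_num) (by nlinarith)
      have h2 : (((2 ^ (2 * d) : ℕ) : ℝ)) ^ 2 * (1 / 2) ^ (4 * d) = 1 := by
        push_cast
        rw [← pow_mul, show 2 * d * 2 = 4 * d by ring, ← mul_pow]
        norm_num
      have h3 : (((2 ^ (2 * d) : ℕ) : ℝ)) ^ 2 * (1 / 2) ^ (72 * d ^ 2) ≤ 1 := by
        exact (mul_le_mul_of_nonneg_left h1 (by positivity)).trans h2.le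
      have h4 : (3 : ℝ) ≤ ((2 ^ (2 * d) : ℕ) : ℝ) := by
        have : 2 ^ 2 ≤ 2 ^ (2 * d) := Nat.pow_le_pow_right (by norm_num) (by omega)
        exact_mod_cast (by omega : 3 ≤ 2 ^ (2 * d))
      push_cast at *
      linarith
    · have h := hfib 1 (fun _ => w) u
      have h1 : numColors f (fun _ : Fin 1 => w) u = 1 := by simp [numColors]
      rw [h1, mul_one] at h
      simpa [hsymm u w, fun v => hsymm v w] using h
  have hall : ∀ B : ℕ, ∃ Q : ℕ, B + 2 ≤ Q ∧ (Q : ℝ) ≤ avgColors f (Q ^ (2 * d)) := by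
    intro B
    induction B with
    | zero => exact ⟨2, le_rfl, hbase⟩
    | succ B ih =>
      obtain ⟨Q, hQB, hQ⟩ := ih
      refine ⟨Q ^ (6 * d), ?_, avgColors_growth hd hvc hfib (by omega) hQ⟩
      have h1 : Q ^ 2 ≤ Q ^ (6 * d) := Nat.pow_le_pow_right (by omega) (by omega)
      nlinarith
  obtain ⟨Q, hQ1, hQ2⟩ := hall (Fintype.card C)
  have h1 := hQ2.trans (avgColors_le_card (f := f) _)
  have : Q ≤ Fintype.card C := by exact_mod_cast h1
  omega

end

/-! ### Edge colors and the dual Sauer–Shelah bound -/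

/-- The color of the pair `u, v`, which is `none` on the diagonal. -/
def edgeColor {n m : ℕ} (χ : SimpleGraph.TopEdgeLabeling (Fin n) (Fin m)) (u v : Fin n) :
    Option (Fin m) :=
  if h : u ≠ v then some (χ.get u v h) else none

section
variable {n m : ℕ} {χ : SimpleGraph.TopEdgeLabeling (Fin n) (Fin m)}

lemma edgeColor_eq_some {u v : Fin n} {i : Fin m} :
    edgeColor χ u v = some i ↔ (χ.labelGraph i).Adj u v := by
  rw [SimpleGraph.TopEdgeLabeling.labelGraph_adj, edgeColor]
  split_ifs with h <;> simp [h]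

lemma edgeColor_eq_none {u v : Fin n} : edgeColor χ u v = none ↔ u = v := by
  rw [edgeColor]
  split_ifs with h <;> simp_all

lemma edgeColor_comm (u v : Fin n) : edgeColor χ u v = edgeColor χ v u := by
  ext i
  rw [edgeColor_eq_some, edgeColor_eq_some, SimpleGraph.adj_comm]

lemma mem_colorNbhd {u v : Fin n} {i : Fin m} :
    u ∈ colorNbhd χ i v ↔ edgeColor χ u v = some i := by
  rw [edgeColor_comm, edgeColor_eq_some]
  simp [colorNbhd]

end

lemma card_image_le_of_factorsThrough {ι β γ : Type*} [DecidableEq β] [DecidableEq γ] [Nonempty β]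
    (s : Finset ι) (g : ι → β) (h : ι → γ) (hgh : g.FactorsThrough h) :
    #(s.image g) ≤ #(s.image h) := by
  have : g = Function.extend h g (fun _ => Classical.arbitrary β) ∘ h :=
    funext fun a => (hgh.extend_apply _ a).symm
  rw [this, ← image_image]
  exact card_image_le

lemma sum_choose_le_pow (M d : ℕ) : ∑ k ∈ range (d + 1), M.choose k ≤ (M + 1) ^ d := by
  rw [add_pow]
  refine sum_le_sum fun k hk => ?_
  have h1 : 0 < d.choose k := Nat.choose_pos (by simpa [Nat.lt_succ_iff] using hk)
  simp only [one_pow, mul_one, Nat.cast_id]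
  exact (Nat.choose_le_pow M k).trans (Nat.le_mul_of_pos_right _ h1)

open Classical in
/-- The dual form of the Sauer–Shelah lemma. -/
lemma card_traces_le {V ι : Type*} [Fintype V] [Fintype ι] (F G : Finset (Finset V)) {d : ℕ}
    (hF : dualVCDim F ≤ d) (hGF : ∀ A ∈ G, A.Nonempty → A ∈ F) (w : ι → V) :
    #(univ.image fun a => G.filter fun A => w a ∈ A) ≤ (#G + 1) ^ d := by
  refine (card_le_card_shatterer _).trans (le_trans ?_ (sum_choose_le_pow #G d))
  simp_rw [← card_powersetCard]
  refine (card_le_card fun S hS => ?_).trans card_biUnion_le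
  rw [mem_shatterer] at hS
  -- Some trace contains all of `S`, so no member of `S` is empty. Thus an empty set in `G` outside
  -- `F` does no harm.
  have hSG : ∀ A ∈ S, A ∈ G ∧ A ∈ F := by
    intro A hA
    obtain ⟨u, hu, hSu⟩ := hS.exists_superset
    obtain ⟨a, -, rfl⟩ := mem_image.1 hu
    have := mem_filter.1 (hSu hA)
    exact ⟨this.1, hGF A this.1 ⟨_, this.2⟩⟩
  have hdual : (dualSystem F).Shatters S := by
    intro t ht
    obtain ⟨u, hu, rfl⟩ := hS ht
    obtain ⟨a, -, rfl⟩ := mem_image.1 hu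
    refine ⟨F.filter fun A => w a ∈ A, mem_image_of_mem _ (mem_univ _), ?_⟩
    ext A
    simp only [mem_inter, mem_filter]
    exact ⟨fun h => ⟨h.1, (hSG A h.1).1, h.2.2⟩, fun h => ⟨h.1, (hSG A h.1).2, h.2.2⟩⟩
  refine mem_biUnion.2 ⟨#S, ?_, mem_powersetCard.2 ⟨fun A hA => (hSG A hA).1, rfl⟩⟩
  rw [mem_range, Nat.lt_succ_iff]
  exact hdual.card_le_vcDim.trans hF

section
variable {n m : ℕ} {χ : SimpleGraph.TopEdgeLabeling (Fin n) (Fin m)}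

-- Collect the neighborhoods `N_i(x j)` over the colors `i` that `x j` sees on `w`. Which of them
-- contain `w a` determines the pattern of `w a`, so `card_traces_le` applies.
open Classical in
lemma card_color_patterns_le {d : ℕ} (hχ : dualVCDim (nbhdSystem χ) ≤ d) {q p : ℕ}
    (x : Fin q → Fin n) (w : Fin p → Fin n) :
    #(univ.image fun a j => edgeColor χ (w a) (x j)) ≤
      (∑ j, numColors (edgeColor χ) w (x j) + 1) ^ d := by
  let nb : Fin q → Option (Fin m) → Finset (Fin n) :=
    fun j o => o.elim ∅ fun i => colorNbhd χ i (x j)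
  let G : Finset (Finset (Fin n)) :=
    univ.biUnion fun j => (univ.image fun a => edgeColor χ (x j) (w a)).image (nb j)
  have hG : #G ≤ ∑ j, numColors (edgeColor χ) w (x j) := by
    refine card_biUnion_le.trans (sum_le_sum fun j _ => ?_)
    rw [numColors]
    convert card_image_le
  have hGF : ∀ A ∈ G, A.Nonempty → A ∈ nbhdSystem χ := by
    intro A hA hne
    obtain ⟨j, -, hA⟩ := mem_biUnion.1 hA
    obtain ⟨o, -, rfl⟩ := mem_image.1 hA
    cases o with
    | none => exact absurd hne (by simp [nb])
    | some i => exact mem_image.2 ⟨(i, x j), mem_univ _, rfl⟩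
  refine le_trans ?_ ((card_traces_le _ G hχ hGF w).trans (by gcongr))
  have key : ∀ a b, (G.filter fun A => w a ∈ A) = (G.filter fun A => w b ∈ A) →
      ∀ j i, edgeColor χ (w a) (x j) = some i → edgeColor χ (w b) (x j) = some i := by
    intro a b hab j i hi
    have h1 : colorNbhd χ i (x j) ∈ G.filter fun A => w a ∈ A := by
      refine mem_filter.2 ⟨mem_biUnion.2 ⟨j, mem_univ _, mem_image.2 ⟨some i, ?_, rfl⟩⟩,
        mem_colorNbhd.2 hi⟩
      exact mem_image.2 ⟨a, mem_univ _, by rw [edgeColor_comm, hi]⟩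
    rw [hab] at h1
    exact mem_colorNbhd.1 (mem_filter.1 h1).2
  have hle := card_image_le_of_factorsThrough (univ : Finset (Fin p))
    (fun a j => edgeColor χ (w a) (x j)) (fun a => G.filter fun A => w a ∈ A)
    fun a b hab => funext fun j => Option.ext fun i => ⟨key a b hab j i, key b a hab.symm j i⟩
  exact hle.trans (le_of_eq (by congr!))

/-! ### Small pattern classes and the induction on clique sizes -/

open Classical in
/-- A set of vertices without monochromatic cliques has small color pattern classes, provided that
smaller forbidden cliques force smaller sets. -/
lemma card_pattern_class_mul_le {c : ℕ} {κ : Fin m → ℕ} (hm : 1 ≤ m) (hκ : ∀ i, 2 ≤ κ i)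
    {U : Finset (Fin n)}
    (hU : 2 ^ (c * ∑ i, κ i) ≤ #U)
    (hno : ∀ i, ∀ t ⊆ U, ¬ (χ.labelGraph i).IsNClique (κ i) t)
    (ih : ∀ κ' : Fin m → ℕ, (∑ i, κ' i < ∑ i, κ i) → (∀ i, 1 ≤ κ' i) →
      ∀ W : Finset (Fin n), 2 ^ (c * ∑ i, κ' i) ≤ #W →
        ∃ i, ∃ t ⊆ W, (χ.labelGraph i).IsNClique (κ' i) t)
    {q : ℕ} (x : Fin q → Fin n) (hx : ∀ j, x j ∈ U) (w : Fin n) :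
    #(U.filter fun w' => ∀ j, edgeColor χ w (x j) = edgeColor χ w' (x j)) *
      2 ^ (c * numColors (edgeColor χ) x w) ≤ #U := by
  set W := U.filter fun w' => ∀ j, edgeColor χ w (x j) = edgeColor χ w' (x j) with hW
  -- Here `w` is an entry of `x`, so its class has at most one vertex, and the colors number at most
  -- `m + 1 ≤ 2 * m ≤ ∑ i, κ i`.
  by_cases hnone : ∃ j, edgeColor χ w (x j) = none
  · obtain ⟨j, hj⟩ := hnone
    have h1 : #W ≤ 1 := by
      refine card_le_one.2 fun u hu v hv => ?_
      have hu' := (mem_filter.1 hu).2 j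
      have hv' := (mem_filter.1 hv).2 j
      rw [hj] at hu' hv'
      rw [edgeColor_eq_none.1 hu'.symm, edgeColor_eq_none.1 hv'.symm]
    have h2 : numColors (edgeColor χ) x w ≤ m + 1 := by
      exact (card_le_univ _).trans_eq (by simp)
    have h3 : 2 * m ≤ ∑ i, κ i := by
      simpa [mul_comm] using card_nsmul_le_sum univ κ 2 fun i _ => hκ i
    calc #W * 2 ^ (c * numColors (edgeColor χ) x w) ≤ 1 * 2 ^ (c * ∑ i, κ i) := by
          gcongr
          · norm_num
          · omega
      _ ≤ #U := by rwa [one_mul]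
  · push Not at hnone
    let I : Finset (Fin m) := univ.filter fun i => ∃ j, edgeColor χ w (x j) = some i
    have hI : #I = numColors (edgeColor χ) x w := by
      rw [numColors, ← card_map (Function.Embedding.some : Fin m ↪ Option (Fin m))]
      congr 1
      ext o
      simp only [mem_map, mem_image, mem_univ, true_and, I, mem_filter]
      constructor
      · rintro ⟨i, ⟨j, hj⟩, rfl⟩
        exact ⟨j, hj⟩
      · rintro ⟨j, rfl⟩
        obtain ⟨i, hi⟩ := Option.ne_none_iff_exists'.1 (hnone j)
        exact ⟨i, ⟨j, hi⟩, hi.symm⟩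
    rw [← hI]
    rcases I.eq_empty_or_nonempty with hI0 | hI0
    · rw [hI0]
      simpa using card_le_card (filter_subset _ _)
    let κ' : Fin m → ℕ := fun i => if i ∈ I then κ i - 1 else κ i
    have hsum : ∑ i, κ' i + #I = ∑ i, κ i := by
      have : #I = ∑ i, if i ∈ I then 1 else 0 := by simp
      rw [this, ← sum_add_distrib]
      refine sum_congr rfl fun i _ => ?_
      have := hκ i
      simp only [κ']
      split_ifs <;> omega
    have hpos : 0 < #I := hI0.card_pos
    have hWlt : #W < 2 ^ (c * ∑ i, κ' i) := by
      by_contra hge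
      obtain ⟨i, t, htW, ht⟩ := ih κ' (by omega) (fun i => by
        have := hκ i
        simp only [κ']
        split_ifs <;> omega) W (not_lt.1 hge)
      have htU : t ⊆ U := htW.trans (filter_subset _ _)
      by_cases hi : i ∈ I
      · obtain ⟨j, hj⟩ := (mem_filter.1 hi).2
        have hκi : κ' i + 1 = κ i := by
          have := hκ i
          simp only [κ', if_pos hi]
          omega
        -- Every vertex of `W` is joined to `x j` in color `i`, so `x j` restores the lost clique
        -- vertex.
        refine hno i (insert (x j) t) (insert_subset (hx j) htU) ?_
        rw [← hκi]
        refine ht.insert fun b hb => ?_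
        rw [← edgeColor_eq_some, edgeColor_comm, ← (mem_filter.1 (htW hb)).2 j, hj]
      · have hκi : κ' i = κ i := if_neg hi
        exact hno i t htU (hκi ▸ ht)
    calc #W * 2 ^ (c * #I) ≤ 2 ^ (c * ∑ i, κ' i) * 2 ^ (c * #I) := by gcongr
      _ = 2 ^ (c * ∑ i, κ i) := by rw [← pow_add, ← mul_add, hsum]
      _ ≤ #U := hU

-- Induction on `∑ i, κ i` over all vertex sets `U`. The pattern classes are subsets of `U`, so the
-- bound is needed for subsets and not only for the whole vertex set.
open Classical in
lemma exists_monochromatic_clique {d : ℕ} (hd : 1 ≤ d) (hm : 1 ≤ m)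
    (hχ : dualVCDim (nbhdSystem χ) ≤ d) (κ : Fin m → ℕ) (hκ : ∀ i, 1 ≤ κ i) (U : Finset (Fin n))
    (hU : 2 ^ (72 * d ^ 2 * ∑ i, κ i) ≤ #U) :
    ∃ i, ∃ t ⊆ U, (χ.labelGraph i).IsNClique (κ i) t := by
  induction hs : ∑ i, κ i using Nat.strong_induction_on generalizing κ U with
  | _ s ih =>
  have hUne : U.Nonempty := card_pos.1 (lt_of_lt_of_le (by positivity) hU)
  by_cases h1 : ∃ i, κ i = 1
  · obtain ⟨i, hi⟩ := h1
    obtain ⟨u, hu⟩ := hUne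
    exact ⟨i, {u}, singleton_subset_iff.2 hu, by simp [SimpleGraph.isNClique_iff, hi]⟩
  push Not at h1
  by_contra hno
  push Not at hno
  have : Nonempty U := hUne.to_subtype
  refine false_of_small_fibers (U := U) (f := fun u v => edgeColor χ u v)
    (fun u v => edgeColor_comm _ _) hd
    (fun q p x w => card_color_patterns_le hχ (fun j => (x j : Fin n)) fun a => (w a : Fin n))
    fun q x w => ?_
  have h2 := card_pattern_class_mul_le (c := 72 * d ^ 2) hm
    (fun i => by have := hκ i; have := h1 i; omega) hU hno
    (fun κ' hlt hκ' W hW => ih _ (hs ▸ hlt) κ' hκ' W hW rfl)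
    (fun j => (x j : Fin n)) (fun j => (x j).2) w
  have h3 : #{w' : U | ∀ j, edgeColor χ w (x j) = edgeColor χ w' (x j)} =
      #(U.filter fun w' => ∀ j, edgeColor χ w (x j) = edgeColor χ w' (x j)) := by
    rw [← card_map (Function.Embedding.subtype (· ∈ U))]
    congr 1
    ext v
    simp [and_comm]
  have h4 : (#(U.filter fun w' => ∀ j, edgeColor χ w (x j) = edgeColor χ w' (x j)) : ℝ) *
      2 ^ (72 * d ^ 2 * numColors (edgeColor χ) (fun j => (x j : Fin n)) w) ≤ #U := by
    exact_mod_cast h2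
  rw [Fintype.card_coe, one_div, inv_pow, ← div_eq_inv_mul, le_div_iff₀ (by positivity)]
  refine le_trans (le_of_eq ?_) h4
  rw [← h3]
  rfl

lemma ramseyProp_two_pow {d : ℕ} (hd : 1 ≤ d) (hm : 1 ≤ m) (κ : Fin m → ℕ) (hκ : ∀ i, 1 ≤ κ i) :
    RamseyProp d κ (2 ^ (72 * d ^ 2 * ∑ i, κ i)) := by
  intro χ hχ
  obtain ⟨i, t, -, ht⟩ := exists_monochromatic_clique hd hm hχ κ hκ univ (by simp)
  exact ⟨i, t, ht⟩

end

theorem theorem2 (d k : ℕ) (hd : 1 ≤ d) (hk : 1 ≤ k) :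
    (∃ c : ℕ, ∀ (m : ℕ), 1 ≤ m → ∀ κ : Fin m → ℕ, (∀ i, 1 ≤ κ i ∧ κ i ≤ k) →
      (∃ n : ℕ, RamseyProp d κ n) ∧ ramseyNumber d κ ≤ 2 ^ (c * ∑ i, κ i)) ∧
    (∃ C : ℕ, ∀ (m : ℕ), 1 ≤ m → ∀ κ : Fin m → ℕ, (∀ i, 1 ≤ κ i ∧ κ i ≤ k) →
      ramseyNumber d κ ≤ 2 ^ (C * m)) := by
  have key : ∀ (m : ℕ), 1 ≤ m → ∀ κ : Fin m → ℕ, (∀ i, 1 ≤ κ i ∧ κ i ≤ k) →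
      RamseyProp d κ (2 ^ (72 * d ^ 2 * ∑ i, κ i)) :=
    fun m hm κ hκ => ramseyProp_two_pow hd hm κ fun i => (hκ i).1
  refine ⟨⟨72 * d ^ 2, fun m hm κ hκ => ⟨⟨_, key m hm κ hκ⟩, Nat.sInf_le (key m hm κ hκ)⟩⟩,
    ⟨72 * d ^ 2 * k, fun m hm κ hκ => (Nat.sInf_le (key m hm κ hκ)).trans ?_⟩⟩
  refine Nat.pow_le_pow_right (by norm_num) ?_
  rw [mul_assoc (72 * d ^ 2) k m]
  refine Nat.mul_le_mul_left _ ?_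
  simpa [mul_comm] using sum_le_card_nsmul univ κ k fun i _ => (hκ i).2
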